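/- **Proposition 2.3 (inclusions).** Let $\mathbb D=\{z\in\mathbb C:|z|<1\}$, let $dm$ be planar Lebesgue measure on $\mathbb D$ normalized so that $m(\mathbb D)=1$, and for $a\in\mathbb D$ put $\varphi_a(z)=\dfrac{a-z}{1-\bar a z}$. For $p\in(0,1)$ and $g$ analytic in $\mathbb D$ let $$\|g\|_{\mathcal D_p}=\Big(|g(0)|^2+\int_{\mathbb D}|g'(z)|^2(1-|z|^2)^p\,dm(z)\Big)^{1/2}\in[0,\infty].$$ For $\lambda,p\in(0,1)$ the Dirichlet–Morrey space $\mathcal D_p^{\lambda}$ is the set of all analytic functions $f$ in $\mathbb D$ such that $$|f(0)|+\sup_{a\in\mathbb D}(1-|a|^2)^{\frac p2(1-\lambda)}\,\|f\circ\varphi_a-f(a)\|_{\mathcal D_p}<\infty .$$ Let $\lambda_1,p_1,\lambda_2,p_2\in(0,1)$. Then $$\mathcal D_{p_1}^{\lambda_1}\subseteq\mathcal D_{p_2}^{\lambda_2}\iff p_1\le p_2\ \text{ and }\ p_1(1-\lambda_1)\le p_2(1-\lambda_2).$$ -/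

import Mathlib

open MeasureTheory
open scoped ENNReal ComplexConjugate

noncomputable section

namespace DirichletMorrey

/-- The open unit disc of the complex plane. -/
def disc : Set ℂ := Metric.ball 0 1

/-- Planar Lebesgue measure on the unit disc, normalized so that the disc has total mass `1`. -/
def discMeasure : Measure ℂ := (volume disc)⁻¹ • volume.restrict disc

/-- The conformal automorphism `z ↦ (a - z) / (1 - conj a * z)` of the disc, which exchanges
`0` and `a`. -/
def discAut (a z : ℂ) : ℂ := (a - z) / (1 - conj a * z)

/-- The norm of the weighted Dirichlet space with parameter `p`, as an extended nonnegative real: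
the square root of `|f 0| ^ 2 + ∫ |f' z| ^ 2 * (1 - |z| ^ 2) ^ p dm(z)`. -/
def dirichletNorm (p : ℝ) (f : ℂ → ℂ) : ℝ≥0∞ :=
  (‖f 0‖ₑ ^ 2 + ∫⁻ z, ‖deriv f z‖ₑ ^ 2 * ENNReal.ofReal ((1 - ‖z‖ ^ 2) ^ p) ∂discMeasure)
    ^ (1 / 2 : ℝ)

/-- The Dirichlet-Morrey norm with parameters `p` and `l`, as an extended nonnegative real. -/
def morreyNorm (p l : ℝ) (f : ℂ → ℂ) : ℝ≥0∞ :=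
  ‖f 0‖ₑ + ⨆ a ∈ disc, ENNReal.ofReal ((1 - ‖a‖ ^ 2) ^ (p / 2 * (1 - l))) *
    dirichletNorm p (fun z => f (discAut a z) - f a)

/-- The Dirichlet-Morrey space: the functions that are holomorphic on the unit disc and have finite
Dirichlet-Morrey norm. Both conditions depend only on the values of `f` on the disc, so a
holomorphic function on the disc is represented by any extension of it to the plane. -/
def space (p l : ℝ) : Set (ℂ → ℂ) :=
  {f | DifferentiableOn ℂ f disc ∧ morreyNorm p l f < ∞}

end DirichletMorrey

end

namespace DirichletMorrey

/-! Sufficiency holds because `1 - ‖z‖ ^ 2` and `1 - ‖a‖ ^ 2` lie in `(0, 1]`: raising an exponent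
only shrinks the norm (`space_mono`).

Necessity uses two families of test functions, each detecting one of the two inequalities. The gap
series `lacunary β` is spread evenly over the circle: it lies in the space when `2 * β < 1 + p` and
not when `2 * β > 1 + p`, whatever `l` is. The function `(1 - z) ^ (-s)` is singular at one boundary
point: it belongs when `2 * s < p * (1 - l)` and fails to when `2 * s > p * (1 - l)`. If either
inequality between the parameters fails, an exponent strictly between the two thresholds gives a
function in the first space but not in the second.

Memberships come from the conformally invariant form `dirichletNorm_comp_discAut`, together with
pointwise bounds on the weight that are uniform in `a`. Both exclusions rest on
`coeff_sq_le_lintegral_disc`, which bounds one Taylor coefficient by a weighted area integral. -/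

/-! ### Automorphisms of the disc and change of variables -/

theorem mem_disc {z : ℂ} : z ∈ disc ↔ ‖z‖ < 1 := by simp [disc]

theorem isOpen_disc : IsOpen disc := Metric.isOpen_ball

theorem measurableSet_disc : MeasurableSet disc := isOpen_disc.measurableSet

theorem volume_disc_ne_zero : volume disc ≠ 0 :=
  (Metric.measure_ball_pos volume (0 : ℂ) one_pos).ne'

theorem volume_disc_ne_top : volume disc ≠ ∞ := measure_ball_lt_top.ne

theorem one_sub_norm_sq_pos {z : ℂ} (hz : z ∈ disc) : 0 < 1 - ‖z‖ ^ 2 := by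
  rw [mem_disc] at hz
  nlinarith [norm_nonneg z]

theorem one_sub_norm_sq_le {z : ℂ} (hz : z ∈ disc) : 1 - ‖z‖ ^ 2 ≤ 2 * (1 - ‖z‖) := by
  rw [mem_disc] at hz
  nlinarith [norm_nonneg z]

theorem one_sub_norm_right_le {a z : ℂ} (ha : a ∈ disc) : 1 - ‖z‖ ≤ ‖1 - conj a * z‖ := by
  rw [mem_disc] at ha
  have h := norm_sub_norm_le 1 (conj a * z)
  have h2 : ‖conj a * z‖ ≤ ‖z‖ := by
    rw [norm_mul, RCLike.norm_conj]
    exact mul_le_of_le_one_left (norm_nonneg z) ha.le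
  rw [norm_one] at h
  linarith

theorem one_sub_norm_left_le {a z : ℂ} (hz : z ∈ disc) : 1 - ‖a‖ ≤ ‖1 - conj a * z‖ := by
  rw [mem_disc] at hz
  have h := norm_sub_norm_le 1 (conj a * z)
  have h2 : ‖conj a * z‖ ≤ ‖a‖ := by
    rw [norm_mul, RCLike.norm_conj]
    exact mul_le_of_le_one_right (norm_nonneg a) hz.le
  rw [norm_one] at h
  linarith

theorem one_sub_conj_mul_ne_zero {a z : ℂ} (ha : a ∈ disc) (hz : z ∈ disc) :
    1 - conj a * z ≠ 0 := by
  have h := one_sub_norm_right_le (z := z) ha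
  rw [mem_disc] at hz
  exact norm_pos_iff.1 (by linarith)

theorem one_sub_norm_discAut_sq {a z : ℂ} (ha : a ∈ disc) (hz : z ∈ disc) :
    1 - ‖discAut a z‖ ^ 2 = (1 - ‖a‖ ^ 2) * (1 - ‖z‖ ^ 2) / ‖1 - conj a * z‖ ^ 2 := by
  have h : ‖1 - conj a * z‖ ^ 2 ≠ 0 := by
    simpa using one_sub_conj_mul_ne_zero ha hz
  rw [discAut, norm_div, div_pow, eq_div_iff h, sub_mul, div_mul_cancel₀ _ h]
  simp only [Complex.sq_norm, Complex.normSq_apply, Complex.sub_re, Complex.sub_im,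
    Complex.mul_re, Complex.mul_im, Complex.conj_re, Complex.conj_im, Complex.one_re,
    Complex.one_im]
  ring

theorem discAut_mem {a z : ℂ} (ha : a ∈ disc) (hz : z ∈ disc) : discAut a z ∈ disc := by
  have h := one_sub_norm_discAut_sq ha hz
  have h0 : 0 < ‖1 - conj a * z‖ := norm_pos_iff.2 (one_sub_conj_mul_ne_zero ha hz)
  have h1 : 0 < 1 - ‖discAut a z‖ ^ 2 := by
    rw [h]
    have := one_sub_norm_sq_pos ha
    have := one_sub_norm_sq_pos hz
    positivity
  rw [mem_disc]
  nlinarith [norm_nonneg (discAut a z)]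

theorem discAut_discAut {a z : ℂ} (ha : a ∈ disc) (hz : z ∈ disc) :
    discAut a (discAut a z) = z := by
  have h := one_sub_conj_mul_ne_zero ha hz
  have h2 := one_sub_conj_mul_ne_zero ha (discAut_mem ha hz)
  have key : discAut a z * (1 - conj a * z) = a - z := div_mul_cancel₀ _ h
  rw [discAut, div_eq_iff h2]
  apply mul_right_cancel₀ h
  linear_combination (-1 + z * conj a) * key

theorem discAut_image {a : ℂ} (ha : a ∈ disc) : discAut a '' disc = disc := by
  ext z
  refine ⟨?_, fun hz => ⟨_, discAut_mem ha hz, discAut_discAut ha hz⟩⟩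
  rintro ⟨w, hw, rfl⟩
  exact discAut_mem ha hw

theorem discAut_injOn {a : ℂ} (ha : a ∈ disc) : Set.InjOn (discAut a) disc := fun x hx y hy h => by
  rw [← discAut_discAut ha hx, h, discAut_discAut ha hy]

theorem hasDerivAt_discAut {a z : ℂ} (ha : a ∈ disc) (hz : z ∈ disc) :
    HasDerivAt (discAut a) (-(1 - ‖a‖ ^ 2) / (1 - conj a * z) ^ 2) z := by
  have h := one_sub_conj_mul_ne_zero ha hz
  have h1 : HasDerivAt (fun z : ℂ => a - z) (-1) z := (hasDerivAt_id z).const_sub a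
  have h2 : HasDerivAt (fun z : ℂ => 1 - conj a * z) (-(conj a * 1)) z :=
    ((hasDerivAt_id z).const_mul (conj a)).const_sub 1
  refine (h1.div h2 h).congr_deriv ?_
  congr 1
  rw [← Complex.mul_conj' a]
  ring

/-- Multiplication by `f' z`, as a real linear map of the plane, has determinant `‖f' z‖ ^ 2`. -/
theorem lintegral_image_eq_lintegral_norm_deriv_sq_mul {s : Set ℂ} (hs : MeasurableSet s)
    {f f' : ℂ → ℂ} (hf : ∀ z ∈ s, HasDerivAt f (f' z) z) (inj : Set.InjOn f s) (g : ℂ → ℝ≥0∞) :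
    ∫⁻ z in f '' s, g z = ∫⁻ z in s, ‖f' z‖ₑ ^ 2 * g (f z) := by
  rw [lintegral_image_eq_lintegral_abs_det_fderiv_mul volume hs
    (fun z hz => ((hf z hz).hasFDerivAt.restrictScalars ℝ).hasFDerivWithinAt) inj]
  refine setLIntegral_congr_fun hs fun z _ => ?_
  have : |(((ContinuousLinearMap.toSpanSingleton ℂ (f' z)).restrictScalars ℝ : ℂ →L[ℝ] ℂ)).det|
      = ‖f' z‖ ^ 2 := by
    simp [ContinuousLinearMap.det, LinearMap.det_restrictScalars, Algebra.norm_complex_apply,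
      Complex.normSq_eq_norm_sq]
  simp only [this]
  rw [ENNReal.ofReal_pow (norm_nonneg _), ofReal_norm]

theorem deriv_comp_discAut {f : ℂ → ℂ} (hf : DifferentiableOn ℂ f disc) {a z : ℂ} (ha : a ∈ disc)
    (hz : z ∈ disc) : deriv (fun z => f (discAut a z) - f a) z =
      deriv f (discAut a z) * (-(1 - ‖a‖ ^ 2) / (1 - conj a * z) ^ 2) := by
  have h := (hf.differentiableAt (isOpen_disc.mem_nhds (discAut_mem ha hz))).hasDerivAt
  exact ((h.comp z (hasDerivAt_discAut ha hz)).sub_const (f a)).deriv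

theorem discAut_zero (a : ℂ) : discAut a 0 = a := by simp [discAut]

theorem lintegral_discMeasure (g : ℂ → ℝ≥0∞) :
    ∫⁻ z, g z ∂discMeasure = (volume disc)⁻¹ * ∫⁻ z in disc, g z := by
  rw [discMeasure, lintegral_smul_measure, smul_eq_mul]

/-- The chain-rule factor is exactly the Jacobian of the involution `discAut a`, so substitution
moves all dependence on `a` into the weight. -/
theorem dirichletNorm_comp_discAut {f : ℂ → ℂ} (hf : DifferentiableOn ℂ f disc) (p : ℝ) {a : ℂ}
    (ha : a ∈ disc) : dirichletNorm p (fun z => f (discAut a z) - f a) =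
      ((volume disc)⁻¹ * ∫⁻ z in disc, ‖deriv f z‖ₑ ^ 2 *
        ENNReal.ofReal ((1 - ‖discAut a z‖ ^ 2) ^ p)) ^ (1 / 2 : ℝ) := by
  rw [dirichletNorm, lintegral_discMeasure]
  congr 1
  simp only [discAut_zero, sub_self, enorm_zero, ne_eq, OfNat.ofNat_ne_zero, not_false_eq_true,
    zero_pow, zero_add]
  congr 1
  conv_rhs => rw [← discAut_image ha]
  rw [lintegral_image_eq_lintegral_norm_deriv_sq_mul measurableSet_disc
    (fun z hz => hasDerivAt_discAut ha hz) (discAut_injOn ha)]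
  refine setLIntegral_congr_fun measurableSet_disc fun z hz => ?_
  simp only [deriv_comp_discAut hf ha hz, discAut_discAut ha hz, enorm_mul, mul_pow]
  ring

/-! ### Sufficiency and a membership criterion -/

theorem dirichletNorm_mono {p q : ℝ} (h : p ≤ q) (f : ℂ → ℂ) :
    dirichletNorm q f ≤ dirichletNorm p f := by
  unfold dirichletNorm
  rw [lintegral_discMeasure, lintegral_discMeasure]
  gcongr ?_ ^ _
  gcongr _ + _ * ?_
  refine setLIntegral_mono' measurableSet_disc fun z hz => ?_
  gcongr _ * ENNReal.ofReal ?_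
  exact Real.rpow_le_rpow_of_exponent_ge (one_sub_norm_sq_pos hz)
    (by nlinarith [norm_nonneg z]) h

theorem space_mono {p₁ l₁ p₂ l₂ : ℝ} (hp : p₁ ≤ p₂) (h : p₁ * (1 - l₁) ≤ p₂ * (1 - l₂)) :
    space p₁ l₁ ⊆ space p₂ l₂ := by
  rintro f ⟨hf, hlt⟩
  refine ⟨hf, lt_of_le_of_lt ?_ hlt⟩
  unfold morreyNorm
  gcongr _ + ?_
  refine iSup₂_mono fun a ha => ?_
  gcongr ENNReal.ofReal ?_ * ?_
  · exact Real.rpow_le_rpow_of_exponent_ge (one_sub_norm_sq_pos ha)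
      (by nlinarith [norm_nonneg a]) (by linarith)
  · exact dirichletNorm_mono hp _

/-- Membership in `space p l` from a uniform bound on the conformally weighted Dirichlet integrals. -/
theorem mem_space_of_lintegral_le {f : ℂ → ℂ} (hf : DifferentiableOn ℂ f disc) {p l : ℝ}
    {C : ℝ≥0∞} (hC : C ≠ ∞) (h : ∀ a ∈ disc, ∫⁻ z in disc, ‖deriv f z‖ₑ ^ 2 *
      ENNReal.ofReal ((1 - ‖a‖ ^ 2) ^ (p * (1 - l)) * (1 - ‖discAut a z‖ ^ 2) ^ p) ≤ C) :
    f ∈ space p l := by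
  refine ⟨hf, ?_⟩
  have hC2 : ((volume disc)⁻¹ * C) ^ (1 / 2 : ℝ) < ∞ :=
    ENNReal.rpow_lt_top_of_nonneg (by norm_num)
      (ENNReal.mul_ne_top (ENNReal.inv_ne_top.2 volume_disc_ne_zero) hC)
  refine ENNReal.add_lt_top.2 ⟨enorm_lt_top, lt_of_le_of_lt (iSup₂_le fun a ha => ?_) hC2⟩
  have ha' := one_sub_norm_sq_pos ha
  have e : (1 - ‖a‖ ^ 2) ^ (p / 2 * (1 - l)) = ((1 - ‖a‖ ^ 2) ^ (p * (1 - l))) ^ (1 / 2 : ℝ) := by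
    rw [← Real.rpow_mul ha'.le]
    congr 1
    ring
  rw [dirichletNorm_comp_discAut hf p ha, e,
    ← ENNReal.ofReal_rpow_of_nonneg (by positivity) (by norm_num),
    ← ENNReal.mul_rpow_of_nonneg _ _ (by norm_num : (0 : ℝ) ≤ 1 / 2)]
  refine ENNReal.rpow_le_rpow ?_ (by norm_num)
  rw [mul_left_comm, ← lintegral_const_mul' _ _ ENNReal.ofReal_ne_top]
  gcongr
  refine le_trans (le_of_eq ?_) (h a ha)
  refine lintegral_congr fun z => ?_
  rw [ENNReal.ofReal_mul (by positivity)]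
  ring

/-! ### Polar coordinates and integrable powers -/

theorem lintegral_ball_polar {G : ℂ → ℝ≥0∞} (hG : Measurable G) (R : ℝ) :
    ∫⁻ z in Metric.ball 0 R, G z = ∫⁻ r in Set.Ioo 0 R, ENNReal.ofReal r *
      ∫⁻ θ in Set.Ioo (-Real.pi) Real.pi, G (circleMap 0 r θ) := by
  have hball : MeasurableSet (Metric.ball (0 : ℂ) R) := measurableSet_ball
  have hcm : Measurable fun x : ℝ × ℝ => circleMap 0 x.1 x.2 := by
    unfold circleMap; fun_prop
  have hG' := hG.indicator hball
  have hpol : ∀ x : ℝ × ℝ, Complex.polarCoord.symm x = circleMap 0 x.1 x.2 := fun x => by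
    rw [Complex.polarCoord_symm_apply, circleMap_zero, Complex.exp_mul_I]
    push_cast
    rfl
  rw [← lintegral_indicator hball, ← Complex.lintegral_comp_polarCoord_symm]
  simp only [hpol, smul_eq_mul]
  rw [polarCoord_target, Measure.volume_eq_prod, setLIntegral_prod]
  · rw [← lintegral_indicator measurableSet_Ioi, ← lintegral_indicator measurableSet_Ioo]
    refine lintegral_congr fun r => ?_
    by_cases h0 : 0 < r
    · rw [Set.indicator_of_mem (Set.mem_Ioi.2 h0)]
      have hm : Measurable fun θ => (Metric.ball (0 : ℂ) R).indicator G (circleMap 0 r θ) :=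
        hG'.comp (measurable_circleMap 0 r)
      dsimp only
      rw [lintegral_const_mul _ hm]
      by_cases h1 : r < R
      · rw [Set.indicator_of_mem (Set.mem_Ioo.2 ⟨h0, h1⟩)]
        congr 1
        refine lintegral_congr fun θ => Set.indicator_of_mem ?_ _
        simp [abs_of_pos h0, h1]
      · rw [Set.indicator_of_notMem (fun h => h1 h.2)]
        have : ∀ θ, (Metric.ball (0 : ℂ) R).indicator G (circleMap 0 r θ) = 0 := fun θ =>
          Set.indicator_of_notMem (by simpa [abs_of_pos h0] using h1) _
        simp [this]
    · rw [Set.indicator_of_notMem (show r ∉ Set.Ioi 0 from h0),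
        Set.indicator_of_notMem (fun h => h0 h.1)]
  · exact (measurable_fst.ennreal_ofReal.mul (hG'.comp hcm)).aemeasurable

theorem lintegral_Ioo_rpow_lt_top {α : ℝ} (hα : -1 < α) (R : ℝ) :
    ∫⁻ r in Set.Ioo 0 R, ENNReal.ofReal (r ^ α) < ∞ := by
  rcases le_or_gt R 0 with h | h
  · simp [Set.Ioo_eq_empty_of_le h]
  have h1 : IntegrableOn (fun x : ℝ => x ^ α) (Set.Ioo 0 R) :=
    (intervalIntegrable_iff_integrableOn_Ioo_of_le h.le).1
      (intervalIntegral.intervalIntegrable_rpow' hα)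
  exact lt_of_le_of_lt (lintegral_mono fun r => by
    rw [← ofReal_norm]; exact ENNReal.ofReal_le_ofReal (le_abs_self _)) h1.2

theorem lintegral_Ioo_one_sub_rpow_lt_top {α : ℝ} (hα : -1 < α) :
    ∫⁻ r in Set.Ioo (0 : ℝ) 1, ENNReal.ofReal ((1 - r) ^ α) < ∞ := by
  have h1 : IntegrableOn (fun x : ℝ => (1 - x) ^ α) (Set.Ioo 0 1) := by
    rw [← intervalIntegrable_iff_integrableOn_Ioo_of_le zero_le_one]
    have := (intervalIntegral.intervalIntegrable_rpow' (a := 0) (b := 1) hα).comp_sub_left 1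
    simpa using this.symm
  exact lt_of_le_of_lt (lintegral_mono fun r => by
    rw [← ofReal_norm]; exact ENNReal.ofReal_le_ofReal (le_abs_self _)) h1.2

theorem lintegral_Ioo_abs_rpow_lt_top {α : ℝ} (hα : -1 < α) (R : ℝ) :
    ∫⁻ r in Set.Ioo (-R) R, ENNReal.ofReal (|r| ^ α) < ∞ := by
  have key := lintegral_Ioo_rpow_lt_top hα R
  have h1 : ∫⁻ r in Set.Ioo 0 R, ENNReal.ofReal (|r| ^ α) < ∞ := by
    refine lt_of_eq_of_lt (setLIntegral_congr_fun measurableSet_Ioo fun r hr => ?_) key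
    simp only [abs_of_pos hr.1]
  have h2 : ∫⁻ r in Set.Ioo (-R) 0, ENNReal.ofReal (|r| ^ α) < ∞ := by
    refine lt_of_eq_of_lt ?_ h1
    have := (Measure.measurePreserving_neg (volume : Measure ℝ)).setLIntegral_comp_preimage_emb
      (MeasurableEquiv.neg ℝ).measurableEmbedding (fun r => ENNReal.ofReal (|r| ^ α))
      (Set.Ioo 0 R)
    rw [← this]
    simp
  have hsub : Set.Ioo (-R) R ⊆ (Set.Ioo (-R) 0 ∪ Set.Ioo 0 R) ∪ {0} := by
    intro x hx
    rcases lt_trichotomy x 0 with h | h | h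
    · exact Or.inl (Or.inl ⟨hx.1, h⟩)
    · exact Or.inr h
    · exact Or.inl (Or.inr ⟨h, hx.2⟩)
  refine (lintegral_mono_set hsub).trans_lt ((lintegral_union_le _ _ _).trans_lt ?_)
  rw [Measure.restrict_singleton]
  simp only [measure_singleton, zero_smul, lintegral_zero_measure, add_zero]
  exact (lintegral_union_le _ _ _).trans_lt (ENNReal.add_lt_top.2 ⟨h2, h1⟩)

theorem lintegral_ball_norm_rpow_lt_top {α : ℝ} (hα : -2 < α) (R : ℝ) :
    ∫⁻ z in Metric.ball (0 : ℂ) R, ENNReal.ofReal (‖z‖ ^ α) < ∞ := by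
  rw [lintegral_ball_polar (by fun_prop)]
  simp only [norm_circleMap_zero, lintegral_const, Measure.restrict_apply_univ, Real.volume_Ioo]
  have h : ∀ r ∈ Set.Ioo 0 R, ENNReal.ofReal r * (ENNReal.ofReal (|r| ^ α) *
      ENNReal.ofReal (Real.pi - -Real.pi)) =
      ENNReal.ofReal (r ^ (1 + α)) * ENNReal.ofReal (Real.pi - -Real.pi) := fun r hr => by
    rw [← mul_assoc, ← ENNReal.ofReal_mul hr.1.le, abs_of_pos hr.1, Real.rpow_add hr.1, Real.rpow_one]
  rw [setLIntegral_congr_fun measurableSet_Ioo h, lintegral_mul_const' _ _ ENNReal.ofReal_ne_top]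
  exact ENNReal.mul_lt_top (lintegral_Ioo_rpow_lt_top (by linarith) R) ENNReal.ofReal_lt_top

theorem lintegral_disc_norm_one_sub_rpow_lt_top {α : ℝ} (hα : -2 < α) :
    ∫⁻ z in disc, ENNReal.ofReal (‖1 - z‖ ^ α) < ∞ := by
  have h := (Measure.measurePreserving_sub_left (volume : Measure ℂ) 1).setLIntegral_comp_preimage_emb
    (MeasurableEquiv.subLeft (1 : ℂ)).measurableEmbedding (fun z => ENNReal.ofReal (‖z‖ ^ α))
    (Metric.ball 0 2)
  refine lt_of_le_of_lt (lintegral_mono_set fun z hz => ?_)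
    (h.trans_lt (lintegral_ball_norm_rpow_lt_top hα 2))
  rw [mem_disc] at hz
  have := norm_sub_le 1 z
  rw [norm_one] at this
  simp only [Set.mem_preimage, mem_ball_zero_iff]
  linarith

/-- The distance from `1` to a point of the disc controls the argument of that point. -/
theorem abs_div_pi_le_norm_one_sub {ρ θ : ℝ} (hρ : 0 ≤ ρ) (hθ : |θ| ≤ Real.pi) :
    |θ| / Real.pi ≤ ‖1 - circleMap 0 ρ θ‖ := by
  have hpi := Real.pi_pos
  have h0 := abs_nonneg θ
  have hre : (1 - circleMap 0 ρ θ).re = 1 - ρ * Real.cos |θ| := by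
    rw [Real.cos_abs]; simp [circleMap_zero, Complex.exp_ofReal_mul_I_re]
  have him : |(1 - circleMap 0 ρ θ).im| = ρ * |Real.sin θ| := by
    simp [circleMap_zero, Complex.exp_ofReal_mul_I_im, abs_mul, abs_of_nonneg hρ]
  have hsq : ‖1 - circleMap 0 ρ θ‖ ^ 2 = (1 - ρ * Real.cos |θ|) ^ 2 + (ρ * |Real.sin θ|) ^ 2 := by
    rw [Complex.sq_norm, Complex.normSq_apply, ← hre, ← him, sq_abs]
    ring
  have hsc : |Real.sin θ| ^ 2 + Real.cos |θ| ^ 2 = 1 := by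
    rw [sq_abs, Real.cos_abs, Real.sin_sq_add_cos_sq]
  refine abs_le_of_sq_le_sq' ?_ (norm_nonneg _) |>.2
  rw [hsq]
  -- The squared distance is `1 - 2ρ cos θ + ρ²`, that is, `sin² θ + (ρ - cos θ)²`. Jordan's
  -- inequality settles small angles; for the others `cos θ ≤ 0` and the distance is at least `1`.
  rcases le_total |θ| (Real.pi / 2) with h | h
  · have hs : 2 / Real.pi * |θ| ≤ |Real.sin θ| := Real.mul_abs_le_abs_sin h
    have h1 : |θ| / Real.pi ≤ |Real.sin θ| := by
      refine le_trans ?_ hs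
      rw [div_eq_inv_mul, div_eq_mul_inv 2]
      have : 0 ≤ Real.pi⁻¹ * |θ| := by positivity
      nlinarith
    have h2 : (|θ| / Real.pi) ^ 2 ≤ |Real.sin θ| ^ 2 := by gcongr
    nlinarith [sq_nonneg (ρ - Real.cos |θ|)]
  · have hc : Real.cos |θ| ≤ 0 := Real.cos_nonpos_of_pi_div_two_le_of_le h (by linarith)
    have h1 : (|θ| / Real.pi) ^ 2 ≤ 1 := by
      rw [sq_le_one_iff₀ (by positivity), div_le_one hpi]
      exact hθ
    nlinarith [mul_nonneg hρ (neg_nonneg.2 hc), sq_nonneg (ρ * |Real.sin θ|)]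

/-! ### Lower bounds from a single power series coefficient -/

theorem integral_exp_int_mul (k : ℤ) : ∫ θ in -Real.pi..Real.pi, Complex.exp (k * Complex.I * θ) =
    if k = 0 then 2 * (Real.pi : ℂ) else 0 := by
  split_ifs with h
  · simp [h]
    ring
  · have hk : (k : ℂ) * Complex.I ≠ 0 := by simp [h]
    rw [integral_exp_mul_complex hk, div_eq_zero_iff]
    left
    rw [sub_eq_zero, Complex.exp_eq_exp_iff_exists_int]
    exact ⟨k, by push_cast; ring⟩

theorem integral_circle_mul_exp_of_hasSum {ι : Type*} [Countable ι] {m : ι → ℕ}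
    (hm : Function.Injective m) {c : ι → ℂ} {h : ℂ → ℂ}
    (hh : ∀ z ∈ disc, HasSum (fun i => c i * z ^ m i) (h z)) (j : ι) {r : ℝ}
    (hr : r ∈ Set.Ioo (0 : ℝ) 1) :
    ∫ θ in -Real.pi..Real.pi, h (circleMap 0 r θ) * Complex.exp (-(m j) * Complex.I * θ) =
      2 * Real.pi * (c j * r ^ m j) := by
  have hmem : ∀ θ, circleMap 0 r θ ∈ disc := fun θ => by
    rw [mem_disc, norm_circleMap_zero, abs_of_pos hr.1]; exact hr.2
  have hexp : ∀ θ : ℝ, ‖Complex.exp (-(m j) * Complex.I * θ)‖ = 1 := fun θ => by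
    rw [Complex.norm_exp]; simp
  have key := intervalIntegral.hasSum_integral_of_dominated_convergence (μ := volume)
    (a := -Real.pi) (b := Real.pi)
    (F := fun i (θ : ℝ) => c i * circleMap 0 r θ ^ m i * Complex.exp (-(m j) * Complex.I * θ))
    (f := fun θ => h (circleMap 0 r θ) * Complex.exp (-(m j) * Complex.I * θ))
    -- This bound does not depend on `θ`, and it is summable because the series converges at the
    -- real point `r`.
    (fun i _ => ‖c i * (r : ℂ) ^ m i‖)
    (fun i => by
      have : Continuous (fun θ : ℝ => c i * circleMap 0 r θ ^ m i *
        Complex.exp (-(m j) * Complex.I * θ)) := by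
        have := continuous_circleMap 0 r
        fun_prop
      exact this.aestronglyMeasurable)
    (fun i => Filter.Eventually.of_forall fun θ _ => by
      rw [norm_mul, hexp, mul_one, norm_mul, norm_mul, norm_pow, norm_pow, norm_circleMap_zero]
      simp)
    (Filter.Eventually.of_forall fun θ _ => (hh r (by
      rw [mem_disc, Complex.norm_real, Real.norm_of_nonneg hr.1.le]; exact hr.2)).summable.norm)
    intervalIntegrable_const
    (Filter.Eventually.of_forall fun θ _ => (hh _ (hmem θ)).mul_right _)
  refine key.unique ?_
  have hterm : ∀ i, ∫ θ in -Real.pi..Real.pi, c i * circleMap 0 r θ ^ m i *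
      Complex.exp (-(m j) * Complex.I * θ) =
      c i * r ^ m i * (if (m i : ℤ) - m j = 0 then 2 * (Real.pi : ℂ) else 0) := fun i => by
    rw [← integral_exp_int_mul, ← intervalIntegral.integral_const_mul]
    refine intervalIntegral.integral_congr fun θ _ => ?_
    have e : Complex.exp (((m i - m j : ℤ) : ℂ) * Complex.I * θ) =
        Complex.exp (m i * (θ * Complex.I)) * Complex.exp (-(m j) * Complex.I * θ) := by
      rw [← Complex.exp_add]
      congr 1
      push_cast
      ring
    simp only [circleMap_zero, mul_pow, ← Complex.exp_nat_mul, e]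
    ring
  simp only [hterm]
  have hs := hasSum_single (f := fun i => c i * (r : ℂ) ^ m i *
    (if (m i : ℤ) - m j = 0 then 2 * (Real.pi : ℂ) else 0)) j fun i hi => by
      rw [if_neg, mul_zero]
      rw [sub_eq_zero]
      exact_mod_cast fun e => hi (hm e)
  rw [sub_self, if_pos rfl, mul_comm (c j * _) _] at hs
  exact hs

theorem sq_lintegral_le {α : Type*} [MeasurableSpace α] {μ : Measure α} {u : α → ℝ≥0∞}
    (hu : AEMeasurable u μ) : (∫⁻ x, u x ∂μ) ^ 2 ≤ μ Set.univ * ∫⁻ x, u x ^ 2 ∂μ := by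
  have h := ENNReal.lintegral_mul_le_Lp_mul_Lq μ Real.HolderConjugate.two_two hu
    (aemeasurable_const (b := (1 : ℝ≥0∞)))
  have h2 := ENNReal.rpow_le_rpow h (by norm_num : (0 : ℝ) ≤ 2)
  rw [ENNReal.mul_rpow_of_nonneg _ _ (by norm_num), ← ENNReal.rpow_mul, ← ENNReal.rpow_mul] at h2
  simp only [Pi.mul_apply, mul_one, lintegral_const,
    ENNReal.rpow_ofNat] at h2
  norm_num at h2
  rwa [mul_comm] at h2

/-- A Fourier coefficient is at most the mean of `‖h‖` over the circle; Cauchy–Schwarz then gives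
this one term of Parseval's identity. -/
theorem coeff_sq_le_lintegral_circle {ι : Type*} [Countable ι] {m : ι → ℕ}
    (hm : Function.Injective m) {c : ι → ℂ} {h : ℂ → ℂ} (hmeas : Measurable h)
    (hh : ∀ z ∈ disc, HasSum (fun i => c i * z ^ m i) (h z)) (j : ι) {r : ℝ}
    (hr : r ∈ Set.Ioo (0 : ℝ) 1) :
    ENNReal.ofReal (2 * Real.pi) * (‖c j‖ₑ ^ 2 * ENNReal.ofReal (r ^ (2 * m j))) ≤
      ∫⁻ θ in Set.Ioo (-Real.pi) Real.pi, ‖h (circleMap 0 r θ)‖ₑ ^ 2 := by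
  have hpi : (0 : ℝ) < 2 * Real.pi := by positivity
  have h1 := integral_circle_mul_exp_of_hasSum hm hh j hr
  rw [intervalIntegral.integral_of_le (by linarith [Real.pi_pos]),
    integral_Ioc_eq_integral_Ioo] at h1
  have h2 := enorm_integral_le_lintegral_enorm (μ := volume.restrict (Set.Ioo (-Real.pi) Real.pi))
    (fun θ : ℝ => h (circleMap 0 r θ) * Complex.exp (-(m j) * Complex.I * θ))
  have hexp : ∀ θ : ℝ, ‖Complex.exp (-(m j) * Complex.I * θ)‖ₑ = 1 := fun θ => by
    rw [← ofReal_norm, Complex.norm_exp]; simp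
  simp only [enorm_mul, hexp, mul_one] at h2
  rw [h1] at h2
  have h3 := (pow_le_pow_left' h2 2).trans (sq_lintegral_le
    (hmeas.comp (measurable_circleMap 0 r)).enorm.aemeasurable)
  rw [Measure.restrict_apply_univ, Real.volume_Ioo, sub_neg_eq_add, ← two_mul] at h3
  have e : ‖2 * (Real.pi : ℂ) * (c j * (r : ℂ) ^ m j)‖ₑ ^ 2 = ENNReal.ofReal (2 * Real.pi) *
      (ENNReal.ofReal (2 * Real.pi) * (‖c j‖ₑ ^ 2 * ENNReal.ofReal (r ^ (2 * m j)))) := by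
    rw [← ofReal_norm, ← ofReal_norm, ← ENNReal.ofReal_pow (norm_nonneg _),
      ← ENNReal.ofReal_pow (norm_nonneg _), ← ENNReal.ofReal_mul (by positivity),
      ← ENNReal.ofReal_mul hpi.le, ← ENNReal.ofReal_mul hpi.le]
    congr 1
    simp only [norm_mul, norm_pow, Complex.norm_real, Real.norm_of_nonneg hr.1.le,
      Real.norm_of_nonneg Real.pi_pos.le, Complex.norm_ofNat]
    ring
  rw [e] at h3
  exact (ENNReal.mul_le_mul_iff_right (by simpa using Real.pi_pos) ENNReal.ofReal_ne_top).1 h3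

/-- With `δ = 1 / (4 * (m j + 1))`, only the annulus `1 - 2δ < r < 1 - δ` is kept. It has width `δ`,
the weight there is at least `δ ^ p`, and `r ^ (2 * m j + 2)` stays above `1 / 4`, whence the factor
`δ ^ (1 + p)`. -/
theorem coeff_sq_le_lintegral_disc {ι : Type*} [Countable ι] {m : ι → ℕ}
    (hm : Function.Injective m) {c : ι → ℂ} {h : ℂ → ℂ} (hmeas : Measurable h)
    (hh : ∀ z ∈ disc, HasSum (fun i => c i * z ^ m i) (h z)) (j : ι) {p : ℝ} (hp : 0 ≤ p) :
    ‖c j‖ₑ ^ 2 * ENNReal.ofReal (1 / 4 * (4 * ((m j : ℝ) + 1)) ^ (-(1 + p))) ≤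
      ∫⁻ z in disc, ‖h z‖ₑ ^ 2 * ENNReal.ofReal ((1 - ‖z‖ ^ 2) ^ p) := by
  set n : ℝ := (m j : ℝ) + 1 with hn
  have hn1 : 1 ≤ n := by simp [hn]
  have hn0 : 0 < n := by linarith
  have hδ : 1 / (4 * n) ≤ 1 / 4 := one_div_le_one_div_of_le (by norm_num) (by linarith)
  have hδ0 : 0 < 1 / (4 * n) := by positivity
  -- Bernoulli's inequality with exponent `m j + 1` gives `1 / 2`, which is then squared. The shift
  -- by one covers `m j = 0` and absorbs the polar factor `r`.
  have hpow : ∀ r : ℝ, 1 - 2 * (1 / (4 * n)) ≤ r → 1 / 4 ≤ r ^ (2 * m j + 2) := fun r hr => by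
    have hb := one_add_mul_le_pow (a := -(2 * (1 / (4 * n)))) (by linarith) (m j + 1)
    have e : (1 : ℝ) + ((m j + 1 : ℕ) : ℝ) * -(2 * (1 / (4 * n))) = 1 / 2 := by
      push_cast
      rw [← hn]
      field_simp
      norm_num
    rw [e] at hb
    have h2 : 1 / 2 ≤ r ^ (m j + 1) :=
      hb.trans (pow_le_pow_left₀ (by linarith) (by linarith) _)
    rw [show 2 * m j + 2 = (m j + 1) * 2 by ring, pow_mul]
    nlinarith
  rw [disc, lintegral_ball_polar (G := fun z => ‖h z‖ₑ ^ 2 * ENNReal.ofReal ((1 - ‖z‖ ^ 2) ^ p))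
    ((hmeas.enorm.pow_const 2).mul (by fun_prop))]
  have hsub : Set.Ioo (1 - 2 * (1 / (4 * n))) (1 - 1 / (4 * n)) ⊆ Set.Ioo (0 : ℝ) 1 :=
    Set.Ioo_subset_Ioo (by linarith) (by linarith)
  refine le_trans ?_ (lintegral_mono_set hsub)
  have hconst : ‖c j‖ₑ ^ 2 * ENNReal.ofReal (1 / 4 * (4 * n) ^ (-(1 + p))) =
      ∫⁻ _ in Set.Ioo (1 - 2 * (1 / (4 * n))) (1 - 1 / (4 * n)),
        ‖c j‖ₑ ^ 2 * ENNReal.ofReal (1 / 4 * (1 / (4 * n)) ^ p) := by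
    rw [lintegral_const, Measure.restrict_apply_univ, Real.volume_Ioo, mul_assoc,
      ← ENNReal.ofReal_mul (by positivity)]
    congr 2
    rw [show 1 - 1 / (4 * n) - (1 - 2 * (1 / (4 * n))) = 1 / (4 * n) by ring, mul_assoc,
      neg_add', Real.rpow_sub (by positivity), Real.rpow_neg_one, Real.div_rpow zero_le_one
      (by positivity), Real.one_rpow]
    field_simp
  rw [hconst]
  refine setLIntegral_mono' measurableSet_Ioo fun r hr => ?_
  have hr' := hsub hr
  simp only [norm_circleMap_zero, abs_of_pos hr'.1]
  rw [lintegral_mul_const' _ _ ENNReal.ofReal_ne_top]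
  refine le_trans ?_ (mul_le_mul_right (mul_le_mul_left
    (coeff_sq_le_lintegral_circle hm hmeas hh j hr') _) _)
  have hr0 := hr'.1
  have e : ENNReal.ofReal r * (ENNReal.ofReal (2 * Real.pi) * (‖c j‖ₑ ^ 2 *
      ENNReal.ofReal (r ^ (2 * m j))) * ENNReal.ofReal ((1 - r ^ 2) ^ p)) = ‖c j‖ₑ ^ 2 *
      ENNReal.ofReal (2 * Real.pi * (r * r ^ (2 * m j)) * (1 - r ^ 2) ^ p) := by
    rw [ENNReal.ofReal_mul (p := 2 * Real.pi * (r * r ^ (2 * m j))) (by positivity),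
      ENNReal.ofReal_mul (p := 2 * Real.pi) (by positivity), ENNReal.ofReal_mul (p := r) hr0.le]
    ring
  rw [e]
  gcongr
  · have h1 := hpow r hr.1.le
    have h2 : r ^ (2 * m j + 2) ≤ r * r ^ (2 * m j) := by
      rw [← pow_succ']
      exact pow_le_pow_of_le_one hr0.le hr'.2.le (by omega)
    have := Real.pi_gt_three
    nlinarith
  · nlinarith [hr.2, hr'.2]

theorem apply_zero_sq_le_lintegral_disc {h : ℂ → ℂ} (hmeas : Measurable h)
    (hd : DifferentiableOn ℂ h disc) {p : ℝ} (hp : 0 ≤ p) :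
    ‖h 0‖ₑ ^ 2 * ENNReal.ofReal (1 / 4 * 4 ^ (-(1 + p))) ≤
      ∫⁻ z in disc, ‖h z‖ₑ ^ 2 * ENNReal.ofReal ((1 - ‖z‖ ^ 2) ^ p) := by
  have := coeff_sq_le_lintegral_disc (m := id) Function.injective_id
    (c := fun n => (n.factorial : ℂ)⁻¹ * iteratedDeriv n h 0) hmeas (fun z hz => by
      refine (Complex.hasSum_taylorSeries_on_ball hd hz).congr_fun fun n => ?_
      simp only [sub_zero, smul_eq_mul, id]
      ring) 0 hp
  simpa using this

/-! ### Bounds on the conformal weight, uniform in `a` -/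

/-- After lowering the exponent `p` to `t`, the base carries two factors `1 - ‖a‖ ^ 2`, each at most
`2 * ‖1 - conj a * z‖`; they cancel the squared denominator. -/
theorem weight_le_one_sub_norm_rpow {a z : ℂ} (ha : a ∈ disc) (hz : z ∈ disc) {t p : ℝ}
    (ht : 0 ≤ t) (htp : t ≤ p) :
    (1 - ‖a‖ ^ 2) ^ t * (1 - ‖discAut a z‖ ^ 2) ^ p ≤ 8 ^ t * (1 - ‖z‖) ^ t := by
  have hA := one_sub_norm_sq_pos ha
  have hZ := one_sub_norm_sq_pos hz
  have hF := one_sub_norm_sq_pos (discAut_mem ha hz)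
  have hA2 := (one_sub_norm_sq_le ha).trans
    (mul_le_mul_of_nonneg_left (one_sub_norm_left_le (a := a) hz) zero_le_two)
  have hZ2 := one_sub_norm_sq_le hz
  have hD : 0 < ‖1 - conj a * z‖ := norm_pos_iff.2 (one_sub_conj_mul_ne_zero ha hz)
  have hz1 : 0 ≤ 1 - ‖z‖ := by linarith
  calc (1 - ‖a‖ ^ 2) ^ t * (1 - ‖discAut a z‖ ^ 2) ^ p
      ≤ (1 - ‖a‖ ^ 2) ^ t * (1 - ‖discAut a z‖ ^ 2) ^ t := by
        gcongr 1
        exact Real.rpow_le_rpow_of_exponent_ge hF (by nlinarith [norm_nonneg (discAut a z)]) htp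
    _ = ((1 - ‖a‖ ^ 2) * (1 - ‖discAut a z‖ ^ 2)) ^ t := by rw [Real.mul_rpow hA.le hF.le]
    _ ≤ (8 * (1 - ‖z‖)) ^ t := by
        refine Real.rpow_le_rpow (by positivity) ?_ ht
        rw [one_sub_norm_discAut_sq ha hz, mul_div_assoc', div_le_iff₀ (by positivity)]
        have h1 : (1 - ‖a‖ ^ 2) ^ 2 ≤ (2 * ‖1 - conj a * z‖) ^ 2 := by gcongr
        calc (1 - ‖a‖ ^ 2) * ((1 - ‖a‖ ^ 2) * (1 - ‖z‖ ^ 2))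
            = (1 - ‖a‖ ^ 2) ^ 2 * (1 - ‖z‖ ^ 2) := by ring
          _ ≤ (2 * ‖1 - conj a * z‖) ^ 2 * (2 * (1 - ‖z‖)) := by gcongr
          _ = _ := by ring
    _ = _ := Real.mul_rpow (by norm_num) hz1

/-- Here the power `t` of `1 - ‖a‖ ^ 2` is discarded, so only one factor of the denominator cancels.
-/
theorem weight_le_mul_norm_rpow_neg {a z : ℂ} (ha : a ∈ disc) (hz : z ∈ disc) {t p : ℝ}
    (ht : 0 ≤ t) (hp : 0 ≤ p) :
    (1 - ‖a‖ ^ 2) ^ t * (1 - ‖discAut a z‖ ^ 2) ^ p ≤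
      4 ^ p * (1 - ‖z‖) ^ p * ‖1 - conj a * z‖ ^ (-p) := by
  have hA := one_sub_norm_sq_pos ha
  have hZ := one_sub_norm_sq_pos hz
  have hF := one_sub_norm_sq_pos (discAut_mem ha hz)
  have hA2 := (one_sub_norm_sq_le ha).trans
    (mul_le_mul_of_nonneg_left (one_sub_norm_left_le (a := a) hz) zero_le_two)
  have hZ2 := one_sub_norm_sq_le hz
  have hD : 0 < ‖1 - conj a * z‖ := norm_pos_iff.2 (one_sub_conj_mul_ne_zero ha hz)
  have hz1 : 0 ≤ 1 - ‖z‖ := by linarith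
  calc (1 - ‖a‖ ^ 2) ^ t * (1 - ‖discAut a z‖ ^ 2) ^ p
      ≤ 1 * (1 - ‖discAut a z‖ ^ 2) ^ p := by
        gcongr
        exact Real.rpow_le_one hA.le (by nlinarith [norm_nonneg a]) ht
    _ ≤ (4 * (1 - ‖z‖) / ‖1 - conj a * z‖) ^ p := by
        rw [one_mul]
        refine Real.rpow_le_rpow hF.le ?_ hp
        rw [one_sub_norm_discAut_sq ha hz, div_le_div_iff₀ (by positivity) hD]
        calc (1 - ‖a‖ ^ 2) * (1 - ‖z‖ ^ 2) * ‖1 - conj a * z‖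
            ≤ (2 * ‖1 - conj a * z‖) * (2 * (1 - ‖z‖)) * ‖1 - conj a * z‖ := by gcongr
          _ = _ := by ring
    _ = _ := by
        rw [Real.div_rpow (by positivity) hD.le, Real.mul_rpow (by norm_num) hz1,
          Real.rpow_neg hD.le]
        rfl

/-! ### The test functions `(1 - z) ^ (-s)` -/

theorem one_sub_mem_slitPlane {z : ℂ} (hz : z ∈ disc) : 1 - z ∈ Complex.slitPlane := by
  rw [mem_disc] at hz
  left
  have := Complex.re_le_norm z
  simp only [Complex.sub_re, Complex.one_re]
  linarith

theorem hasDerivAt_one_sub_cpow (s : ℝ) {z : ℂ} (hz : z ∈ disc) :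
    HasDerivAt (fun z : ℂ => (1 - z) ^ (-s : ℂ)) (s * (1 - z) ^ ((-s - 1 : ℝ) : ℂ)) z := by
  have h := ((hasDerivAt_id z).const_sub 1).cpow_const (c := (-s : ℂ)) (one_sub_mem_slitPlane hz)
  refine h.congr_deriv ?_
  push_cast
  simp

theorem norm_deriv_one_sub_cpow {s : ℝ} (hs : 0 ≤ s) {z : ℂ} (hz : z ∈ disc) :
    ‖deriv (fun z : ℂ => (1 - z) ^ (-s : ℂ)) z‖ = s * ‖1 - z‖ ^ (-s - 1) := by
  rw [(hasDerivAt_one_sub_cpow s hz).deriv, norm_mul, Complex.norm_cpow_real, Complex.norm_real,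
    Real.norm_of_nonneg hs]

theorem differentiableOn_one_sub_cpow (s : ℝ) :
    DifferentiableOn ℂ (fun z : ℂ => (1 - z) ^ (-s : ℂ)) disc := fun _ hz =>
  (hasDerivAt_one_sub_cpow s hz).differentiableAt.differentiableWithinAt

theorem enorm_sq_mul_ofReal (w : ℂ) (x : ℝ) :
    ‖w‖ₑ ^ 2 * ENNReal.ofReal x = ENNReal.ofReal (‖w‖ ^ 2 * x) := by
  rw [ENNReal.ofReal_mul (by positivity), ENNReal.ofReal_pow (norm_nonneg _), ofReal_norm]

/-- The weight is at most a constant times `‖1 - z‖ ^ t`, which leaves the exponent `t - 2 * s - 2`;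
it exceeds `-2`, the threshold for integrability in the plane. -/
theorem one_sub_cpow_mem_space {p l s : ℝ} (hp : 0 ≤ p) (hl : l ∈ Set.Icc (0 : ℝ) 1) (hs : 0 ≤ s)
    (h : 2 * s < p * (1 - l)) : (fun z : ℂ => (1 - z) ^ (-s : ℂ)) ∈ space p l := by
  set t := p * (1 - l) with ht
  have ht0 : 0 ≤ t := mul_nonneg hp (by linarith [hl.2])
  have htp : t ≤ p := by nlinarith [hl.1]
  have hfin : ∫⁻ z in disc, ENNReal.ofReal (s ^ 2 * 8 ^ t) *
      ENNReal.ofReal (‖1 - z‖ ^ (t - 2 * s - 2)) < ∞ := by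
    rw [lintegral_const_mul' _ _ ENNReal.ofReal_ne_top]
    exact ENNReal.mul_lt_top ENNReal.ofReal_lt_top
      (lintegral_disc_norm_one_sub_rpow_lt_top (by linarith))
  refine mem_space_of_lintegral_le (differentiableOn_one_sub_cpow s) hfin.ne fun a ha =>
    setLIntegral_mono' measurableSet_disc fun z hz => ?_
  have hz' := mem_disc.1 hz
  have h1 : 1 - ‖z‖ ≤ ‖1 - z‖ := by simpa using norm_sub_norm_le 1 z
  have h1z : 0 < ‖1 - z‖ := by linarith
  rw [enorm_sq_mul_ofReal, norm_deriv_one_sub_cpow hs hz, ← ENNReal.ofReal_mul (by positivity)]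
  refine ENNReal.ofReal_le_ofReal ?_
  have e : (‖1 - z‖ ^ (-s - 1)) ^ 2 * ‖1 - z‖ ^ t = ‖1 - z‖ ^ (t - 2 * s - 2) := by
    rw [← Real.rpow_natCast, ← Real.rpow_mul h1z.le, ← Real.rpow_add h1z]
    congr 1
    push_cast
    ring
  calc (s * ‖1 - z‖ ^ (-s - 1)) ^ 2 * ((1 - ‖a‖ ^ 2) ^ t * (1 - ‖discAut a z‖ ^ 2) ^ p)
      ≤ (s * ‖1 - z‖ ^ (-s - 1)) ^ 2 * (8 ^ t * ‖1 - z‖ ^ t) := by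
        refine mul_le_mul_of_nonneg_left
          ((weight_le_one_sub_norm_rpow ha hz ht0 htp).trans ?_) (by positivity)
        have : 0 ≤ 1 - ‖z‖ := by linarith
        gcongr
    _ = s ^ 2 * 8 ^ t * ((‖1 - z‖ ^ (-s - 1)) ^ 2 * ‖1 - z‖ ^ t) := by ring
    _ = _ := by rw [e]

/-- The derivative of `f ∘ discAut a` at `0` has modulus `(1 - ‖a‖ ^ 2) * ‖deriv f a‖`, and its
Dirichlet integral controls this constant coefficient. -/
theorem exists_norm_deriv_le_of_mem_space {f : ℂ → ℂ} {p l : ℝ} (hp : 0 ≤ p)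
    (hf : f ∈ space p l) :
    ∃ C : ℝ, ∀ a ∈ disc, (1 - ‖a‖ ^ 2) ^ (p / 2 * (1 - l) + 1) * ‖deriv f a‖ ≤ C := by
  obtain ⟨hd, hlt⟩ := hf
  have hM := (ENNReal.add_lt_top.1 hlt).2
  set M := ⨆ a ∈ disc, ENNReal.ofReal ((1 - ‖a‖ ^ 2) ^ (p / 2 * (1 - l))) *
    dirichletNorm p (fun z => f (discAut a z) - f a) with hMdef
  set K := (volume disc)⁻¹ * ENNReal.ofReal (1 / 4 * 4 ^ (-(1 + p))) with hK
  have hK0 : K ^ (1 / 2 : ℝ) ≠ 0 := by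
    have h4 : (0 : ℝ) < 1 / 4 * 4 ^ (-(1 + p)) := by positivity
    have h1 : K ≠ 0 := mul_ne_zero (ENNReal.inv_ne_zero.2 volume_disc_ne_top)
      (ENNReal.ofReal_pos.2 h4).ne'
    have h2 : K ≠ ∞ := ENNReal.mul_ne_top (ENNReal.inv_ne_top.2 volume_disc_ne_zero)
      ENNReal.ofReal_ne_top
    exact (ENNReal.rpow_pos h1.bot_lt h2).ne'
  clear_value K
  refine ⟨(M / K ^ (1 / 2 : ℝ)).toReal, fun a ha => ?_⟩
  have hA := one_sub_norm_sq_pos ha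
  refine (ENNReal.ofReal_le_iff_le_toReal (ENNReal.div_ne_top hM.ne hK0)).1 ?_
  rw [ENNReal.le_div_iff_mul_le (Or.inl hK0) (Or.inr hM.ne)]
  refine le_trans ?_ (le_iSup₂ (f := fun a (_ : a ∈ disc) =>
    ENNReal.ofReal ((1 - ‖a‖ ^ 2) ^ (p / 2 * (1 - l))) *
    dirichletNorm p (fun z => f (discAut a z) - f a)) a ha)
  have hg : DifferentiableOn ℂ (fun z => f (discAut a z) - f a) disc := fun z hz =>
    (((hd.differentiableAt (isOpen_disc.mem_nhds (discAut_mem ha hz))).comp z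
      (hasDerivAt_discAut ha hz).differentiableAt).sub_const (f a)).differentiableWithinAt
  have h0 : (0 : ℂ) ∈ disc := by simp [mem_disc]
  have hlow := apply_zero_sq_le_lintegral_disc (measurable_deriv _) (hg.deriv isOpen_disc) hp
  rw [deriv_comp_discAut hd ha h0, discAut_zero] at hlow
  have hnorm : ‖deriv f a * (-(1 - ‖a‖ ^ 2) / (1 - conj a * 0) ^ 2)‖ₑ =
      ENNReal.ofReal ((1 - ‖a‖ ^ 2) * ‖deriv f a‖) := by
    rw [← ofReal_norm]
    congr 1
    have : (-(1 - (‖a‖ : ℂ) ^ 2)) = ((-(1 - ‖a‖ ^ 2) : ℝ) : ℂ) := by push_cast; ring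
    rw [mul_zero, sub_zero, one_pow, div_one, norm_mul, this, Complex.norm_real, norm_neg,
      Real.norm_of_nonneg hA.le, mul_comm]
  rw [hnorm] at hlow
  rw [Real.rpow_add hA, Real.rpow_one, mul_assoc, ENNReal.ofReal_mul (by positivity), mul_assoc]
  gcongr
  rw [dirichletNorm, lintegral_discMeasure]
  refine le_trans ?_ (ENNReal.rpow_le_rpow (le_add_left le_rfl) (by norm_num))
  refine le_trans ?_ (ENNReal.rpow_le_rpow (mul_le_mul_right hlow _) (by norm_num))
  rw [mul_left_comm, ← hK, ENNReal.mul_rpow_of_nonneg _ _ (by norm_num : (0 : ℝ) ≤ 1 / 2),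
    ← ENNReal.rpow_natCast, ← ENNReal.rpow_mul]
  norm_num

theorem one_sub_cpow_notMem_space {p l s : ℝ} (hp : 0 ≤ p) (hl : l ≤ 1) (hs : 0 < s)
    (h : p * (1 - l) < 2 * s) : (fun z : ℂ => (1 - z) ^ (-s : ℂ)) ∉ space p l := fun hmem => by
  obtain ⟨C, hC⟩ := exists_norm_deriv_le_of_mem_space hp hmem
  set u := p / 2 * (1 - l) with hu
  have hu0 : 0 ≤ u := mul_nonneg (by linarith) (by linarith)
  have hus : u - s < 0 := by linarith
  -- At the radial point `a = 1 - y` the growth bound would dominate `s * y ^ (u - s)`, which is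
  -- unbounded as `y → 0`.
  have hlim := (tendsto_rpow_neg_nhdsGT_zero hus).const_mul_atTop hs
  obtain ⟨y, hy, hy01⟩ := ((hlim.eventually_gt_atTop C).and
    (Ioo_mem_nhdsGT (zero_lt_one' ℝ))).exists
  have hyd : ((1 - y : ℝ) : ℂ) ∈ disc := by
    rw [mem_disc, Complex.norm_real, Real.norm_of_nonneg (by linarith [hy01.2])]
    linarith [hy01.1]
  have hb := hC _ hyd
  rw [norm_deriv_one_sub_cpow hs.le hyd, Complex.norm_real,
    Real.norm_of_nonneg (by linarith [hy01.2])] at hb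
  have e1 : ‖1 - ((1 - y : ℝ) : ℂ)‖ = y := by
    rw [← Complex.ofReal_one, ← Complex.ofReal_sub, Complex.norm_real, sub_sub_cancel,
      Real.norm_of_nonneg hy01.1.le]
  rw [e1] at hb
  refine absurd (lt_of_lt_of_le hy ?_) (lt_irrefl C)
  refine le_trans ?_ hb
  have hy0 := hy01.1
  calc s * y ^ (u - s) = y ^ (u + 1) * (s * y ^ (-s - 1)) := by
        rw [mul_left_comm, ← Real.rpow_add hy0]
        ring_nf
    _ ≤ _ := by
        gcongr
        nlinarith [hy01.2]

/-! ### Lacunary series -/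

/-- A gap series whose derivative is `∑ 2 ^ (k * β) * z ^ (2 ^ k - 1)`. -/
noncomputable def lacunary (β : ℝ) (z : ℂ) : ℂ :=
  ∑' k : ℕ, ((((2 : ℝ) ^ (β - 1)) ^ k : ℝ) : ℂ) * z ^ (2 ^ k)

section lacunary

variable {β : ℝ}

theorem summable_two_rpow_pow {x : ℝ} (hx : x < 0) : Summable fun k : ℕ => ((2 : ℝ) ^ x) ^ k :=
  summable_geometric_of_lt_one (by positivity) (Real.rpow_lt_one_of_one_lt_of_neg one_lt_two hx)

theorem norm_lacunary_term_le (k : ℕ) {z : ℂ} (hz : z ∈ disc) :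
    ‖((((2 : ℝ) ^ (β - 1)) ^ k : ℝ) : ℂ) * z ^ (2 ^ k)‖ ≤ ((2 : ℝ) ^ (β - 1)) ^ k := by
  rw [norm_mul, norm_pow, Complex.norm_real, Real.norm_of_nonneg (by positivity)]
  exact mul_le_of_le_one_right (by positivity)
    (pow_le_one₀ (norm_nonneg z) (mem_disc.1 hz).le)

theorem differentiableOn_lacunary (hβ : β < 1) : DifferentiableOn ℂ (lacunary β) disc :=
  Complex.differentiableOn_tsum_of_summable_norm (summable_two_rpow_pow (x := β - 1) (by linarith))
    (fun _ => by fun_prop) isOpen_disc fun k _ hz => norm_lacunary_term_le k hz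

theorem hasSum_deriv_lacunary (hβ : β < 1) {z : ℂ} (hz : z ∈ disc) :
    HasSum (fun k : ℕ => ((((2 : ℝ) ^ β) ^ k : ℝ) : ℂ) * z ^ (2 ^ k - 1))
      (deriv (lacunary β) z) := by
  have h := Complex.hasSum_deriv_of_summable_norm
    (F := fun (k : ℕ) (z : ℂ) => ((((2 : ℝ) ^ (β - 1)) ^ k : ℝ) : ℂ) * z ^ (2 ^ k))
    (summable_two_rpow_pow (x := β - 1) (by linarith))
    (fun _ => by fun_prop) isOpen_disc (fun k _ hz => norm_lacunary_term_le k hz) hz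
  refine h.congr_fun fun k => ?_
  rw [deriv_const_mul_field, deriv_pow_field, ← mul_assoc]
  congr 1
  rw [Real.rpow_sub_one two_ne_zero, div_pow]
  push_cast
  field_simp

theorem mul_pow_pred_le {x : ℝ} (hx : 0 ≤ x) (hx1 : x < 1) (m : ℕ) :
    m * x ^ (m - 1) ≤ (1 - x)⁻¹ := by
  have h1 : (m : ℝ) * x ^ (m - 1) ≤ ∑ i ∈ Finset.range m, x ^ i := by
    have h := Finset.card_nsmul_le_sum (Finset.range m) (fun i => x ^ i) (x ^ (m - 1))
      fun i hi => pow_le_pow_of_le_one hx hx1.le (Nat.le_sub_one_of_lt (Finset.mem_range.1 hi))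
    simpa using h
  refine h1.trans ?_
  rw [← one_div, le_div_iff₀ (by linarith), geom_sum_mul_neg]
  linarith [pow_nonneg hx m]

/-- Raising `m * x ^ (m - 1) ≤ 1 / (1 - x)` to the power `γ` bounds the `k`-th term by `2 ^ (k * (β
- γ)) * (1 - ‖z‖) ^ (-γ)`; the gap `β < γ` makes this geometric. -/
theorem norm_deriv_lacunary_le (hβ : β < 1) {γ : ℝ} (hβγ : β < γ) (hγ0 : 0 ≤ γ) (hγ : γ ≤ 1)
    {z : ℂ} (hz : z ∈ disc) :
    ‖deriv (lacunary β) z‖ ≤ (∑' k : ℕ, ((2 : ℝ) ^ (β - γ)) ^ k) * (1 - ‖z‖) ^ (-γ) := by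
  have hz1 := mem_disc.1 hz
  have hz0 := norm_nonneg z
  have hs := (summable_two_rpow_pow (x := β - γ) (by linarith)).mul_right ((1 - ‖z‖) ^ (-γ))
  rw [← (hasSum_deriv_lacunary hβ hz).tsum_eq, ← tsum_mul_right]
  refine tsum_of_norm_bounded hs.hasSum fun k => ?_
  rw [norm_mul, norm_pow, Complex.norm_real, Real.norm_of_nonneg (by positivity)]
  have h1 : ‖z‖ ^ (2 ^ k - 1) ≤ (‖z‖ ^ (2 ^ k - 1)) ^ γ := by
    conv_lhs => rw [← Real.rpow_one (‖z‖ ^ (2 ^ k - 1))]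
    exact Real.rpow_le_rpow_of_exponent_ge_of_imp (by positivity) (pow_le_one₀ hz0 hz1.le) hγ
      (fun _ h => absurd h one_ne_zero)
  have h2 := Real.rpow_le_rpow (by positivity) (mul_pow_pred_le hz0 hz1 (2 ^ k)) hγ0
  rw [Real.mul_rpow (by positivity) (by positivity), Real.inv_rpow (by linarith),
    ← Real.rpow_neg (by linarith)] at h2
  have e : ((2 : ℝ) ^ β) ^ k = ((2 : ℝ) ^ (β - γ)) ^ k * (((2 ^ k : ℕ) : ℝ)) ^ γ := by
    push_cast
    rw [← Real.rpow_natCast, ← Real.rpow_natCast, ← Real.rpow_natCast, ← Real.rpow_mul two_pos.le,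
      ← Real.rpow_mul two_pos.le, ← Real.rpow_mul two_pos.le, ← Real.rpow_add two_pos]
    ring_nf
  rw [e, mul_assoc]
  gcongr
  exact (mul_le_mul_of_nonneg_left h1 (by positivity)).trans h2

end lacunary

/-- A rotation makes `a` nonnegative real. Then `‖1 - conj a * z‖ ≥ |θ| / π` separates the variables
and removes `a`; `p < 1` makes the angular integral finite, `δ > -1` the radial one. -/
theorem exists_lintegral_rpow_mul_norm_rpow_le {δ p : ℝ} (hδ : -1 < δ) (hp0 : 0 ≤ p) (hp : p < 1) :
    ∃ C : ℝ≥0∞, C ≠ ∞ ∧ ∀ a ∈ disc, ∫⁻ z in disc,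
      ENNReal.ofReal ((1 - ‖z‖) ^ δ * ‖1 - conj a * z‖ ^ (-p)) ≤ C := by
  have hpi := Real.pi_pos
  have hA := lintegral_Ioo_abs_rpow_lt_top (α := -p) (by linarith) Real.pi
  have hR := lintegral_Ioo_one_sub_rpow_lt_top hδ
  set A := ∫⁻ r in Set.Ioo (-Real.pi) Real.pi, ENNReal.ofReal (|r| ^ (-p))
  refine ⟨(∫⁻ r in Set.Ioo (0 : ℝ) 1, ENNReal.ofReal ((1 - r) ^ δ)) *
    (ENNReal.ofReal (Real.pi ^ p) * A), ENNReal.mul_ne_top hR.ne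
      (ENNReal.mul_ne_top ENNReal.ofReal_ne_top hA.ne), fun a ha => ?_⟩
  have hrot := (rotation (Circle.exp a.arg)).measurePreserving.setLIntegral_comp_preimage_emb
    (rotation (Circle.exp a.arg)).toHomeomorph.measurableEmbedding
    (fun z => ENNReal.ofReal ((1 - ‖z‖) ^ δ * ‖1 - conj a * z‖ ^ (-p))) disc
  have hpre : (rotation (Circle.exp a.arg)) ⁻¹' disc = disc := by
    ext z
    simp [mem_disc]
  have hmul : ∀ z : ℂ, conj a * rotation (Circle.exp a.arg) z = ‖a‖ * z := fun z => by
    have e : conj a * (Circle.exp a.arg : ℂ) = ‖a‖ := by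
      have h1 : (‖a‖ : ℂ) * Circle.exp a.arg = a := by
        rw [Circle.coe_exp, Complex.norm_mul_exp_arg_mul_I]
      have h2 : conj (Circle.exp a.arg : ℂ) * Circle.exp a.arg = 1 := by
        rw [← Complex.normSq_eq_conj_mul_self, Circle.normSq_coe, Complex.ofReal_one]
      have h3 : conj a = ‖a‖ * conj (Circle.exp a.arg : ℂ) := by
        rw [← Complex.conj_ofReal ‖a‖, ← map_mul, h1]
      rw [h3, mul_assoc, h2, mul_one]
    rw [rotation_apply, ← mul_assoc, e]
  rw [← hrot, hpre]
  simp only [hmul, LinearIsometryEquiv.norm_map]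
  rw [disc, lintegral_ball_polar (by fun_prop), ← lintegral_mul_const' _ _
    (ENNReal.mul_ne_top ENNReal.ofReal_ne_top hA.ne)]
  refine setLIntegral_mono' measurableSet_Ioo fun r hr => ?_
  have hr1 : ENNReal.ofReal r ≤ 1 := ENNReal.ofReal_le_one.2 hr.2.le
  refine (mul_le_of_le_one_left' hr1).trans ?_
  have h1r : 0 ≤ 1 - r := by linarith [hr.2]
  rw [← mul_assoc, ← ENNReal.ofReal_mul (by positivity),
    ← lintegral_const_mul' _ _ ENNReal.ofReal_ne_top]
  -- For `p > 0` the power `|θ| ^ (-p)` takes the default value `0` at `θ = 0`, so the comparison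
  -- fails at this null point.
  have hne : ∀ᵐ θ : ℝ, θ ≠ 0 := Measure.ae_ne volume 0
  refine lintegral_mono_ae ?_
  filter_upwards [ae_restrict_of_ae hne, ae_restrict_mem measurableSet_Ioo] with θ hθ hθm
  have hθa : |θ| ≤ Real.pi := (abs_lt.2 hθm).le
  have hθ0 : 0 < |θ| := abs_pos.2 hθ
  have hcm : (‖a‖ : ℂ) * circleMap 0 r θ = circleMap 0 (‖a‖ * r) θ := by
    simp [circleMap_zero, mul_assoc]
  rw [norm_circleMap_zero, abs_of_pos hr.1, hcm, ← ENNReal.ofReal_mul (by positivity), mul_assoc]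
  refine ENNReal.ofReal_le_ofReal ?_
  gcongr
  have hb := abs_div_pi_le_norm_one_sub (mul_nonneg (norm_nonneg a) hr.1.le) hθa
  refine (Real.rpow_le_rpow_of_nonpos (by positivity) hb (by linarith)).trans (le_of_eq ?_)
  rw [Real.div_rpow hθ0.le hpi.le, Real.rpow_neg hpi.le, div_inv_eq_mul, mul_comm]

theorem lacunary_mem_space {β p l : ℝ} (hβ : β < 1) (hβ0 : 0 ≤ β) (hp : p ∈ Set.Ioo (0 : ℝ) 1)
    (hl : l ≤ 1) (h : 2 * β < 1 + p) : lacunary β ∈ space p l := by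
  -- Above `β` for the derivative bound, below `(1 + p) / 2` so that the radial exponent `p - 2 * γ`
  -- exceeds `-1`.
  obtain ⟨γ, hγ1, hγ2⟩ := exists_between (show β < (1 + p) / 2 by linarith)
  have hγ3 : γ ≤ 1 := by linarith [hp.2]
  obtain ⟨C, hC, hle⟩ := exists_lintegral_rpow_mul_norm_rpow_le (δ := p - 2 * γ) (by linarith)
    hp.1.le hp.2
  set S := ∑' k : ℕ, ((2 : ℝ) ^ (β - γ)) ^ k
  refine mem_space_of_lintegral_le (differentiableOn_lacunary hβ)
    (C := ENNReal.ofReal (S ^ 2 * 4 ^ p) * C) (ENNReal.mul_ne_top ENNReal.ofReal_ne_top hC)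
    fun a ha => ?_
  refine le_trans ?_ (mul_le_mul_right (hle a ha) _)
  rw [← lintegral_const_mul' _ _ ENNReal.ofReal_ne_top]
  refine setLIntegral_mono' measurableSet_disc fun z hz => ?_
  have hz0 : 0 < 1 - ‖z‖ := by linarith [mem_disc.1 hz]
  rw [enorm_sq_mul_ofReal, ← ENNReal.ofReal_mul (by positivity)]
  refine ENNReal.ofReal_le_ofReal ?_
  have h1 : ‖deriv (lacunary β) z‖ ^ 2 ≤ (S * (1 - ‖z‖) ^ (-γ)) ^ 2 := by
    gcongr
    exact norm_deriv_lacunary_le hβ hγ1 (by linarith) hγ3 hz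
  have h2 := weight_le_mul_norm_rpow_neg ha hz (t := p * (1 - l))
    (mul_nonneg hp.1.le (by linarith)) hp.1.le
  have e : ((1 - ‖z‖) ^ (-γ)) ^ 2 * (1 - ‖z‖) ^ p = (1 - ‖z‖) ^ (p - 2 * γ) := by
    rw [← Real.rpow_natCast, ← Real.rpow_mul hz0.le, ← Real.rpow_add hz0]
    congr 1
    push_cast
    ring
  refine (mul_le_mul_of_nonneg_right h1 ?_).trans
    ((mul_le_mul_of_nonneg_left h2 (by positivity)).trans (le_of_eq ?_))
  · have := (one_sub_norm_sq_pos ha).le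
    have := (one_sub_norm_sq_pos (discAut_mem ha hz)).le
    positivity
  · rw [← e]
    ring

theorem lintegral_deriv_lt_top_of_mem_space {f : ℂ → ℂ} {p l : ℝ} (hf : f ∈ space p l) :
    ∫⁻ z in disc, ‖deriv f z‖ₑ ^ 2 * ENNReal.ofReal ((1 - ‖z‖ ^ 2) ^ p) < ∞ := by
  obtain ⟨hd, hlt⟩ := hf
  have h0 : (0 : ℂ) ∈ disc := by simp [mem_disc]
  have h := (le_iSup₂ (f := fun a (_ : a ∈ disc) =>
    ENNReal.ofReal ((1 - ‖a‖ ^ 2) ^ (p / 2 * (1 - l))) *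
    dirichletNorm p (fun z => f (discAut a z) - f a)) 0 h0).trans_lt (ENNReal.add_lt_top.1 hlt).2
  rw [dirichletNorm_comp_discAut hd p h0] at h
  have hn : ∀ z, ‖discAut 0 z‖ = ‖z‖ := fun z => by simp [discAut]
  simp only [norm_zero, ne_eq, OfNat.ofNat_ne_zero, not_false_eq_true, zero_pow, sub_zero,
    Real.one_rpow, ENNReal.ofReal_one, one_mul, hn] at h
  rw [ENNReal.rpow_lt_top_iff_of_pos (by norm_num)] at h
  exact ENNReal.lt_top_of_mul_ne_top_right h.ne (ENNReal.inv_ne_zero.2 volume_disc_ne_top)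

/-- The coefficient `2 ^ (k * β)` in degree `2 ^ k - 1` forces the Dirichlet integral, the case `a =
0`, above a constant times `2 ^ (k * (2 * β - (1 + p)))` for every `k`. -/
theorem lacunary_notMem_space {β p l : ℝ} (hβ : β < 1) (hp : 0 ≤ p) (h : 1 + p < 2 * β) :
    lacunary β ∉ space p l := fun hmem => by
  have hI := lintegral_deriv_lt_top_of_mem_space hmem
  set I := ∫⁻ z in disc, ‖deriv (lacunary β) z‖ₑ ^ 2 * ENNReal.ofReal ((1 - ‖z‖ ^ 2) ^ p)
  have hinj : Function.Injective fun k : ℕ => 2 ^ k - 1 := fun i j hij => by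
    have h1 := Nat.one_le_two_pow (n := i)
    have h2 := Nat.one_le_two_pow (n := j)
    exact Nat.pow_right_injective le_rfl (by simp only at hij ⊢; omega)
  have hb : ∀ k : ℕ, 1 / 4 * 4 ^ (-(1 + p)) * ((2 : ℝ) ^ (2 * β - (1 + p))) ^ k ≤ I.toReal :=
    fun k => by
    have hk := coeff_sq_le_lintegral_disc hinj (measurable_deriv (lacunary β))
      (fun z hz => hasSum_deriv_lacunary hβ hz) k hp
    rw [enorm_sq_mul_ofReal] at hk
    refine le_trans (le_of_eq ?_) ((ENNReal.ofReal_le_iff_le_toReal hI.ne).1 hk)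
    have e1 : (((2 ^ k - 1 : ℕ) : ℝ) + 1) = (2 : ℝ) ^ (k : ℝ) := by
      rw [Nat.cast_sub Nat.one_le_two_pow]
      simp
    rw [e1, Complex.norm_real, Real.norm_of_nonneg (by positivity),
      Real.mul_rpow (by norm_num) (by positivity), ← Real.rpow_natCast (_ ^ _) k,
      ← Real.rpow_natCast (_ ^ _) k, ← Real.rpow_natCast _ 2, ← Real.rpow_mul two_pos.le,
      ← Real.rpow_mul two_pos.le, ← Real.rpow_mul two_pos.le, ← Real.rpow_mul two_pos.le]
    have e2 : (2 : ℝ) ^ ((2 * β - (1 + p)) * k) =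
        2 ^ (β * k * (2 : ℕ)) * 2 ^ (k * -(1 + p)) := by
      rw [← Real.rpow_add two_pos]
      congr 1
      push_cast
      ring
    rw [e2]
    ring
  have hlim := (tendsto_pow_atTop_atTop_of_one_lt
    (Real.one_lt_rpow one_lt_two (show 0 < 2 * β - (1 + p) by linarith))).const_mul_atTop
    (show (0 : ℝ) < 1 / 4 * 4 ^ (-(1 + p)) by positivity)
  obtain ⟨k, hk⟩ := (hlim.eventually_gt_atTop I.toReal).exists
  exact absurd (hb k) (not_le.2 hk)

end DirichletMorrey

theorem proposition2p3 (l₁ p₁ l₂ p₂ : ℝ)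
    (hl₁ : l₁ ∈ Set.Ioo (0 : ℝ) 1) (hp₁ : p₁ ∈ Set.Ioo (0 : ℝ) 1)
    (hl₂ : l₂ ∈ Set.Ioo (0 : ℝ) 1) (hp₂ : p₂ ∈ Set.Ioo (0 : ℝ) 1) :
    DirichletMorrey.space p₁ l₁ ⊆ DirichletMorrey.space p₂ l₂ ↔
      p₁ ≤ p₂ ∧ p₁ * (1 - l₁) ≤ p₂ * (1 - l₂) := by
  refine ⟨fun hsub => ⟨?_, ?_⟩, fun h => DirichletMorrey.space_mono h.1 h.2⟩
  · by_contra! hlt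
    obtain ⟨q, hq₂, hq₁⟩ := exists_between hlt
    -- From `p₂ < q < p₁`, the choice of `β` gives `1 + p₂ < 2 * β < 1 + p₁`, and `β < 1` since `p₁
    -- < 1`.
    refine DirichletMorrey.lacunary_notMem_space (β := (1 + q) / 2) (by linarith [hp₁.2]) hp₂.1.le
      (by linarith) (hsub (DirichletMorrey.lacunary_mem_space (by linarith [hp₁.2])
        (by linarith [hp₂.1]) hp₁ hl₁.2.le (by linarith)))
  · by_contra! hlt
    obtain ⟨q, hq₂, hq₁⟩ := exists_between hlt
    have hq : 0 < q := (mul_pos hp₂.1 (by linarith [hl₂.2])).trans hq₂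
    exact DirichletMorrey.one_sub_cpow_notMem_space (s := q / 2) hp₂.1.le hl₂.2.le (by linarith)
      (by linarith) (hsub (DirichletMorrey.one_sub_cpow_mem_space hp₁.1.le
        ⟨hl₁.1.le, hl₁.2.le⟩ (by linarith) (by linarith)))
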